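/- Let $F=\mathbb{F}_q$ be a finite field. Let $(m,n,\mathcal{X},f)$ be an instance of the index coding problem with side information: $n$ messages $x_1,\dots,x_n\in\mathbb{F}_q$ and $m$ receivers, where receiver $i$ owns the messages indexed by $\mathcal{X}_i\subseteq[n]$ and requests $x_{f(i)}$, with $f(i)\notin\mathcal{X}_i$. Assume that every message is requested by at least one receiver. Put $$\kappa_q=\min\bigl\{\operatorname{rank}\{u^{(i)}+e_{f(i)}\}_{i\in[m]} : u^{(i)}\in\mathbb{F}_q^n,\ \operatorname{supp}(u^{(i)})\subseteq\mathcal{X}_i\bigr\},$$ where $e_j$ denotes the $j$-th unit vector. Let $\mu,t,\delta,\eta,N\ge 0$ be integers with $t\le n-1$, and let $L$ be an $(n+\eta)\times N$ matrix over $\mathbb{F}_q$, with encoding $(x,g)\mapsto (x\,|\,g)L$ for $x\in\mathbb{F}_q^n$ and $g\in\mathbb{F}_q^\eta$. Suppose that the resulting linear $\eta$-randomized index code is $(\mu,t,\delta)$-strongly secure, that is: 1. ($\delta$-error correction) for every $i\in[m]$ there is a function $D_i:\mathbb{F}_q^N\times\mathbb{F}_q^{|\mathcal{X}_i|}\to\mathbb{F}_q$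 with $D_i((x\,|\,g)L+\xi,\,x_{\mathcal{X}_i})=x_{f(i)}$ for all $x\in\mathbb{F}_q^n$, all $g\in\mathbb{F}_q^\eta$ and all $\xi\in\mathbb{F}_q^N$ of Hamming weight at most $\delta$; 2. ($(\mu,t)$-strong security) if $X$ and $G$ are independent and uniformly distributed over $\mathbb{F}_q^n$ and $\mathbb{F}_q^\eta$, then for every $A\subseteq[n]$ with $|A|=t$ and every set $W\subseteq[N]$ of at most $\mu$ columns, $$H\bigl(X_{[n]\setminus A}\,\big|\,(X\,|\,G)L[W],\,X_A\bigr)=H\bigl(X_{[n]\setminus A}\bigr),$$ where $H$ is Shannon entropy and $L[W]$ is the submatrix of $L$ formed by the columns indexed by $W$. Then the length of the code satisfies $N\ge\kappa_q+\mu+2\delta$. -/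

import Mathlib

namespace IndexCoding

/-- An instance `(m, n, 𝒳, f)` of the Index Coding with Side Information problem: receiver `i`
owns the messages indexed by `side i` and requests the message indexed by `demand i`. -/
structure Instance (m n : ℕ) where
  side : Fin m → Finset (Fin n)
  demand : Fin m → Fin n
  demand_notMem_side : ∀ i, demand i ∉ side i

/-- The possible ranks of a family `(u⁽ⁱ⁾ + e_{f(i)})ᵢ` with `supp u⁽ⁱ⁾ ⊆ 𝒳ᵢ`. -/
def rankSet (F : Type*) [Field F] {m n : ℕ} (I : Instance m n) : Set ℕ :=
  {r | ∃ u : Fin m → Fin n → F, (∀ i, Function.support (u i) ⊆ ↑(I.side i)) ∧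
    r = Set.finrank F (Set.range fun i => u i + Pi.single (I.demand i) 1)}

theorem rankSet_nonempty (F : Type*) [Field F] {m n : ℕ} (I : Instance m n) :
    (rankSet F I).Nonempty :=
  ⟨_, fun _ => 0, fun i => by simp, rfl⟩

/-- `κ_q(m, n, 𝒳, f)`, a minimum because `rankSet` is nonempty. -/
noncomputable def kappa (F : Type*) [Field F] {m n : ℕ} (I : Instance m n) : ℕ :=
  sInf (rankSet F I)

/-- `Pr(Y = y)` as a real number. -/
noncomputable def prob {Ω S : Type*} (P : PMF Ω) (Y : Ω → S) (y : S) : ℝ :=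
  (P.map Y y).toReal

/-- The binary Shannon entropy `H(Y) = -∑ Pr(Y = y) log₂ Pr(Y = y)`. -/
noncomputable def entropy {Ω S : Type*} [Fintype S] (P : PMF Ω) (Y : Ω → S) : ℝ :=
  -∑ y, prob P Y y * Real.logb 2 (prob P Y y)

/-- The binary conditional entropy `H(Y | Z) = -∑ Pr(Y = y, Z = z) log₂ Pr(Y = y | Z = z)`. -/
noncomputable def condEntropy {Ω S T : Type*} [Fintype S] [Fintype T] (P : PMF Ω)
    (Y : Ω → S) (Z : Ω → T) : ℝ :=
  -∑ y, ∑ z, prob P (fun ω => (Y ω, Z ω)) (y, z) *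
    Real.logb 2 (prob P (fun ω => (Y ω, Z ω)) (y, z) / prob P Z z)

/-- The joint law of the message vector `X` and the random vector `G`: all `n + η` coordinates
are independent and uniformly distributed over `F`. -/
noncomputable def uniformLaw (F : Type*) [Field F] [Fintype F] (n η : ℕ) :
    PMF ((Fin n → F) × (Fin η → F)) :=
  PMF.uniformOfFintype _

/-- The linear encoding `(x, g) ↦ (x | g) L`, where the rows of `L` are indexed by the `n` messages
followed by the `η` random symbols, and its columns by the transmissions. -/
def encode {F : Type*} [Field F] {n η : ℕ} {C : Type*} (L : Matrix (Fin n ⊕ Fin η) C F)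
    (x : Fin n → F) (g : Fin η → F) : C → F :=
  Matrix.vecMul (Sum.elim x g) L

/-- `E` is a `δ`-error-correcting `η`-randomized index code of length `N` for the instance `I`:
every receiver has a decoding function, depending only on the received word and on its side
information, which recovers its demand whenever at most `δ` symbols are in error. -/
def IsErrorCorrecting {F : Type*} [Field F] [DecidableEq F] {m n η N : ℕ} (I : Instance m n)
    (δ : ℕ) (E : (Fin n → F) → (Fin η → F) → (Fin N → F)) : Prop :=
  ∀ i : Fin m, ∃ D : (Fin N → F) → (↥(I.side i) → F) → F,
    ∀ (x : Fin n → F) (g : Fin η → F) (ξ : Fin N → F), hammingNorm ξ ≤ δ →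
      D (E x g + ξ) (fun j => x j) = x (I.demand i)

/-- `(μ, t)`-strong security: an adversary who owns any `t` messages `x_A` and listens to any set
`W` of at most `μ` transmissions gains no information about the other messages, that is,
`H(X_{Aᶜ} | (X | G) L[W], X_A) = H(X_{Aᶜ})`. -/
def IsSecure {F : Type*} [Field F] [Fintype F] {n η N : ℕ} (μ t : ℕ)
    (L : Matrix (Fin n ⊕ Fin η) (Fin N) F) : Prop :=
  ∀ A : Finset (Fin n), A.card = t → ∀ W : Finset (Fin N), W.card ≤ μ →
    condEntropy (uniformLaw F n η)
      (fun ω => fun j : ↥(Aᶜ) => ω.1 j)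
      (fun ω => (encode (L.submatrix id (fun w : ↥W => (w : Fin N))) ω.1 ω.2,
        fun j : ↥A => ω.1 j)) =
    entropy (uniformLaw F n η) (fun ω => fun j : ↥(Aᶜ) => ω.1 j)

/-- The linear `η`-randomized index code based on `L` is `(μ, t, δ)`-strongly secure. -/
def IsStronglySecure {F : Type*} [Field F] [Fintype F] [DecidableEq F] {m n η N : ℕ}
    (I : Instance m n) (μ t δ : ℕ) (L : Matrix (Fin n ⊕ Fin η) (Fin N) F) : Prop :=
  IsErrorCorrecting I δ (encode L) ∧ IsSecure μ t L

end IndexCoding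

/-! Discard `2δ` columns of `L`. Error correction still places, for every receiver, some `u⁽ⁱ⁾ +
e_{f(i)}`, padded with zeros on the random coordinates, in the span of the remaining columns
(`IsErrorCorrecting.exists_mem_span`). These vectors span a space `V` of dimension at least `κ`. As
`V` consists of combinations of messages alone, security makes it meet the span of any `μ` columns
trivially (`IsSecure.disjoint`). So `V` and `μ` independent remaining columns fit as a direct sum
inside a span of at most `N - 2δ` vectors (`finrank_add_le_card`). -/

namespace IndexCoding

open Submodule

section Entropy

variable {Ω S T : Type*}

theorem prob_nonneg (P : PMF Ω) (Y : Ω → S) (y : S) : 0 ≤ prob P Y y :=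
  ENNReal.toReal_nonneg

theorem prob_eq_zero_iff (P : PMF Ω) (Y : Ω → S) (y : S) :
    prob P Y y = 0 ↔ ∀ ω ∈ P.support, Y ω ≠ y := by
  rw [prob, ENNReal.toReal_eq_zero_iff, or_iff_left ((P.map Y).apply_ne_top y),
    PMF.apply_eq_zero_iff, PMF.mem_support_map_iff]
  push Not
  rfl

theorem prob_pos (P : PMF Ω) (Y : Ω → S) {ω : Ω} (h : ω ∈ P.support) : 0 < prob P Y (Y ω) :=
  lt_of_le_of_ne (prob_nonneg P Y _) fun h0 => (prob_eq_zero_iff P Y _).1 h0.symm ω h rfl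

theorem sum_prob [Fintype S] (P : PMF Ω) (Y : Ω → S) : ∑ y, prob P Y y = 1 := by
  have h := (P.map Y).tsum_coe
  rw [tsum_fintype] at h
  simp only [prob]
  rw [← ENNReal.toReal_sum fun y _ => (P.map Y).apply_ne_top y, h, ENNReal.toReal_one]

theorem sum_prob_map [Fintype S] (P : PMF Ω) (Y : Ω → S) (g : S → T) [DecidableEq T] (t : T) :
    prob P (fun ω => g (Y ω)) t = ∑ y, if t = g y then prob P Y y else 0 := by
  have h : P.map (fun ω => g (Y ω)) = (P.map Y).map g := (PMF.map_comp Y P g).symm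
  rw [prob, h, PMF.map_apply, tsum_fintype, ENNReal.toReal_sum]
  · refine Finset.sum_congr rfl fun y _ => ?_
    split_ifs <;> rfl
  · intro y _
    split_ifs
    · exact (P.map Y).apply_ne_top y
    · exact ENNReal.zero_ne_top

theorem sum_prob_pair_right [Fintype S] [Fintype T] (P : PMF Ω) (Y : Ω → S) (Z : Ω → T) (y : S) :
    ∑ z, prob P (fun ω => (Y ω, Z ω)) (y, z) = prob P Y y := by
  classical
  have h := sum_prob_map P (fun ω => (Y ω, Z ω)) Prod.fst y
  rw [Fintype.sum_prod_type_right] at h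
  simpa using h.symm

/-- Conditioning on `Z` strictly lowers the entropy of `Y` as soon as some value of `Y` and some
value of `Z`, each of positive probability, exclude each other. -/
theorem condEntropy_lt_entropy [Fintype S] [Fintype T] (P : PMF Ω) (Y : Ω → S) (Z : Ω → T)
    {y₀ : S} {z₀ : T} (hy : 0 < prob P Y y₀) (hz : 0 < prob P Z z₀)
    (hyz : prob P (fun ω => (Y ω, Z ω)) (y₀, z₀) = 0) :
    condEntropy P Y Z < entropy P Y := by
  set p := prob P (fun ω => (Y ω, Z ω)) with hp
  have hlog : 0 < Real.log 2 := Real.log_pos (by norm_num)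
  have hent : entropy P Y = -∑ y, ∑ z, p (y, z) * Real.logb 2 (prob P Y y) := by
    rw [entropy]
    congr 1
    refine Finset.sum_congr rfl fun y _ => ?_
    rw [← Finset.sum_mul, sum_prob_pair_right]
  have hpos : ∀ y z, p (y, z) ≠ 0 → 0 < p (y, z) ∧ 0 < prob P Y y ∧ 0 < prob P Z z := by
    intro y z h
    rw [hp, Ne, prob_eq_zero_iff] at h
    push Not at h
    obtain ⟨ω, hω, h⟩ := h
    obtain ⟨rfl, rfl⟩ := Prod.mk.inj h
    exact ⟨prob_pos P (fun ω => (Y ω, Z ω)) hω, prob_pos P Y hω, prob_pos P Z hω⟩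
  -- Termwise Gibbs inequality: `log s ≤ s - 1` at `s = P(y)P(z) / p(y,z)`. At `(y₀, z₀)` it is
  -- strict, since `p` vanishes there and the product does not.
  have hle : ∀ y z, Real.log 2 * (p (y, z) * Real.logb 2 (prob P Y y)
      - p (y, z) * Real.logb 2 (p (y, z) / prob P Z z)) ≤ prob P Y y * prob P Z z - p (y, z) := by
    intro y z
    by_cases h : p (y, z) = 0
    · simp [h, mul_nonneg (prob_nonneg P Y y) (prob_nonneg P Z z)]
    · obtain ⟨h1, h2, h3⟩ := hpos y z h
      have key := Real.log_le_sub_one_of_pos (div_pos (mul_pos h2 h3) h1)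
      rw [Real.log_div (mul_pos h2 h3).ne' h, Real.log_mul h2.ne' h3.ne'] at key
      rw [Real.logb, Real.logb, Real.log_div h h3.ne']
      calc _ = p (y, z) * (Real.log (prob P Y y) + Real.log (prob P Z z)
              - Real.log (p (y, z))) := by field_simp; ring
        _ ≤ p (y, z) * (prob P Y y * prob P Z z / p (y, z) - 1) :=
              mul_le_mul_of_nonneg_left key h1.le
        _ = _ := by field_simp
  have hsum : ∑ y, ∑ z, (prob P Y y * prob P Z z - p (y, z)) = 0 := by
    simp only [Finset.sum_sub_distrib, ← Finset.mul_sum, hp, sum_prob_pair_right, sum_prob, mul_one,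
      sub_self, Finset.sum_const_zero]
  have hlt : ∑ y, ∑ z, Real.log 2 * (p (y, z) * Real.logb 2 (prob P Y y)
      - p (y, z) * Real.logb 2 (p (y, z) / prob P Z z)) < 0 := by
    rw [← hsum]
    refine Finset.sum_lt_sum (fun y _ => Finset.sum_le_sum fun z _ => hle y z)
      ⟨y₀, Finset.mem_univ _, Finset.sum_lt_sum (fun z _ => hle y₀ z) ⟨z₀, Finset.mem_univ _, ?_⟩⟩
    simpa [hyz] using mul_pos hy hz
  simp only [← Finset.mul_sum, Finset.sum_sub_distrib] at hlt
  rw [hent, condEntropy]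
  exact neg_lt_neg (sub_neg.1 (neg_of_mul_neg_right hlt hlog.le))

end Entropy

/-- If a subspace `V` of the span of `|J|` vectors meets trivially the span of any `μ` of them, then
`dim V + μ ≤ |J|`. -/
theorem finrank_add_le_card {K E ι : Type*} [Field K] [AddCommGroup E] [Module K E]
    (v : ι → E) (J : Finset ι) (μ : ℕ) (V : Submodule K E) (hV : V ≠ ⊥)
    (hVJ : V ≤ span K (v '' J))
    (hdisj : ∀ W ⊆ J, W.card ≤ μ → Disjoint V (span K (v '' W))) :
    Module.finrank K V + μ ≤ J.card := by
  classical
  obtain ⟨b, hbJ, -, hspan, hli⟩ :=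
    exists_linearIndepOn_extension (linearIndepOn_empty K v) (Set.empty_subset (J : Set ι))
  lift b to Finset ι using J.finite_toSet.subset hbJ
  have hbJ' : b ⊆ J := by exact_mod_cast hbJ
  have hVb : V ≤ span K (v '' b) := hVJ.trans (span_le.2 hspan)
  -- Fewer than `μ` independent vectors would already span a space containing `V`, so disjointness
  -- would make `V` trivial.
  have hμ : μ ≤ b.card := by
    by_contra! h
    exact hV ((hdisj b hbJ' h.le).eq_bot_of_le hVb)
  obtain ⟨W, hWb, hW⟩ := Finset.exists_subset_card_eq hμ
  have hd := hdisj W (hWb.trans hbJ') hW.le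
  have hfin : ∀ s : Finset ι, FiniteDimensional K (span K (v '' s)) := fun s =>
    FiniteDimensional.span_of_finite K (s.finite_toSet.image v)
  have := hfin b
  have := hfin W
  have : FiniteDimensional K V := finiteDimensional_of_le hVb
  have hrank : Module.finrank K (span K (v '' W)) = μ := by
    have h := finrank_span_eq_card (hli.mono (Finset.coe_subset.2 hWb)).linearIndependent
    rw [← Set.image_eq_range] at h
    exact h.trans ((Fintype.card_coe W).trans hW)
  have hb : Module.finrank K (span K (v '' b)) ≤ b.card := by
    rw [← Finset.coe_image]
    exact (finrank_span_finset_le_card _).trans Finset.card_image_le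
  calc Module.finrank K V + μ = Module.finrank K ↥(V ⊔ span K (v '' W)) := by
        rw [← hrank, ← finrank_sup_add_finrank_inf_eq, hd.eq_bot, finrank_bot, add_zero]
    _ ≤ Module.finrank K (span K (v '' b)) := Submodule.finrank_mono
        (sup_le hVb (span_mono (Set.image_mono (Finset.coe_subset.2 hWb))))
    _ ≤ b.card := hb
    _ ≤ J.card := Finset.card_le_card hbJ'

variable {F : Type*} [Field F] {n η : ℕ}

/-- The embedding `a ↦ (a | 0)` of `F ^ n` into `F ^ (n + η)`. -/
def extendZero (F : Type*) [Field F] (n η : ℕ) : (Fin n → F) →ₗ[F] (Fin n ⊕ Fin η → F) where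
  toFun a := Sum.elim a 0
  map_add' a b := by ext (i | i) <;> simp
  map_smul' c a := by ext (i | i) <;> simp

theorem extendZero_apply (a : Fin n → F) : extendZero F n η a = Sum.elim a 0 := rfl

theorem extendZero_injective : Function.Injective (extendZero F n η) := fun a b h => by
  ext i
  exact congrFun h (Sum.inl i)

theorem dotProduct_extendZero (x : Fin n → F) (g : Fin η → F) (a : Fin n → F) :
    Sum.elim x g ⬝ᵥ extendZero F n η a = x ⬝ᵥ a := by
  simp [extendZero_apply]

theorem encode_zero {C : Type*} (L : Matrix (Fin n ⊕ Fin η) C F) : encode L 0 0 = 0 := by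
  simp [encode]

theorem encode_apply {C : Type*} (L : Matrix (Fin n ⊕ Fin η) C F) (x : Fin n → F)
    (g : Fin η → F) (c : C) : encode L x g c = Sum.elim x g ⬝ᵥ L.col c := rfl

/-- If a codeword vanishes outside `2δ` positions and the side information is zero, then so is the
demanded message. -/
theorem IsErrorCorrecting.demand_eq_zero [DecidableEq F] {m N : ℕ} {I : Instance m n} {δ : ℕ}
    {L : Matrix (Fin n ⊕ Fin η) (Fin N) F} (h : IsErrorCorrecting I δ (encode L)) (i : Fin m)
    (x : Fin n → F) (g : Fin η → F) (hx : ∀ j ∈ I.side i, x j = 0)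
    (hL : ∀ c : Fin N, 2 * δ ≤ c → encode L x g c = 0) : x (I.demand i) = 0 := by
  obtain ⟨D, hD⟩ := h i
  have card_lt : ∀ a : ℕ, (Finset.univ.filter fun c : Fin N => a ≤ c ∧ (c : ℕ) < a + δ).card ≤ δ := by
    intro a
    calc _ ≤ (Finset.Ico a (a + δ)).card :=
          Finset.card_le_card_of_injOn (fun c : Fin N => (c : ℕ)) (fun c hc => by simpa using hc)
            Fin.val_injective.injOn
      _ = δ := by simp
  have wt : ∀ (a : ℕ) (y : Fin N → F),
      hammingNorm (fun c : Fin N => if a ≤ c ∧ (c : ℕ) < a + δ then y c else 0) ≤ δ := by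
    intro a y
    refine le_trans (Finset.card_le_card fun c hc => ?_) (card_lt a)
    simp only [Finset.mem_filter, Finset.mem_univ, true_and] at hc ⊢
    by_contra hc'
    exact hc (if_neg hc')
  -- Erasing positions `[0, δ)` of the codeword, or adding its positions `[δ, 2δ)` to the zero
  -- codeword, gives the same received word, so the decoder cannot tell `(x, g)` from `(0, 0)`.
  have h1 := hD x g _ (wt 0 (-encode L x g))
  have h2 := hD 0 0 _ (wt δ (encode L x g))
  rw [encode_zero, zero_add] at h2
  refine h1.symm.trans (Eq.trans ?_ h2)
  congr 1
  · ext c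
    simp only [Pi.add_apply, Pi.neg_apply]
    by_cases hc : (c : ℕ) < δ
    · simp [hc, hc.not_ge]
    · by_cases hc2 : (c : ℕ) < δ + δ
      · simp [hc, hc2, not_lt.1 hc]
      · simp [hc, hc2, hL c (by omega)]
  · ext j
    simp [hx j j.2]

/-- From the columns that remain after deleting `2δ` of them, each receiver can form a
combination that involves only its demand and its side information. -/
theorem IsErrorCorrecting.exists_mem_span [DecidableEq F] {m N : ℕ} {I : Instance m n} {δ : ℕ}
    {L : Matrix (Fin n ⊕ Fin η) (Fin N) F} (h : IsErrorCorrecting I δ (encode L)) (i : Fin m) :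
    ∃ u : Fin n → F, Function.support u ⊆ ↑(I.side i) ∧
      extendZero F n η (u + Pi.single (I.demand i) 1) ∈ span F (L.col '' {c | 2 * δ ≤ (c : ℕ)}) := by
  set C := span F (L.col '' {c | 2 * δ ≤ (c : ℕ)}) with hC
  set U : Submodule F (Fin n → F) := Submodule.pi (↑(I.side i))ᶜ fun _ => ⊥ with hU
  have hmem : extendZero F n η (Pi.single (I.demand i) 1) ∈ C ⊔ U.map (extendZero F n η) := by
    -- Duality: the coordinates of a functional killing `C` and `U` but not the demanded unit vector
    -- form an input `(x | g)` that contradicts `demand_eq_zero`.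
    by_contra hn
    obtain ⟨φ, hφ, hker⟩ := Submodule.exists_le_ker_of_notMem hn
    set z : Fin n ⊕ Fin η → F := fun k => φ (Pi.single k 1) with hz
    have hφz : ∀ w, φ w = z ⬝ᵥ w := by
      intro w
      conv_lhs => rw [pi_eq_sum_univ' w]
      simp [dotProduct, hz, mul_comm]
    have hsplit : Sum.elim (fun j => z (Sum.inl j)) (fun k => z (Sum.inr k)) = z :=
      Sum.elim_comp_inl_inr z
    have hzero := h.demand_eq_zero i (fun j => z (Sum.inl j)) (fun k => z (Sum.inr k)) ?_ ?_
    · apply hφ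
      rw [hφz, ← hsplit, dotProduct_extendZero]
      simpa using hzero
    · intro j hj
      have hjU : extendZero F n η (Pi.single j 1) ∈ U.map (extendZero F n η) := by
        refine mem_map_of_mem fun k hk => ?_
        have : k ≠ j := fun e => hk (e ▸ hj)
        simp [this]
      have := hker (mem_sup_right hjU)
      rw [LinearMap.mem_ker, hφz, ← hsplit, dotProduct_extendZero] at this
      simpa using this
    · intro c hc
      have := hker (mem_sup_left (subset_span ⟨c, hc, rfl⟩))
      rw [LinearMap.mem_ker, hφz] at this
      rw [encode_apply, hsplit, this]
  obtain ⟨c, hc, _, ⟨u, hu, rfl⟩, hsum⟩ := mem_sup.1 hmem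
  refine ⟨-u, fun j hj => ?_, ?_⟩
  · by_contra hj'
    exact hj (by simpa using hu j hj')
  · rw [map_add, map_neg, ← hsum]
    simpa using hc

/-- No nontrivial combination of messages alone lies in the span of `μ` columns. -/
theorem IsSecure.disjoint [Fintype F] {N μ t : ℕ} {L : Matrix (Fin n ⊕ Fin η) (Fin N) F}
    (h : IsSecure μ t L) (ht : t < n) {W : Finset (Fin N)} (hW : W.card ≤ μ) :
    Disjoint (LinearMap.range (extendZero F n η)) (span F (L.col '' W)) := by
  classical
  rw [Submodule.disjoint_def]
  rintro _ ⟨a, rfl⟩ ha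
  by_contra hne
  have ha0 : a ≠ 0 := fun e => hne (by rw [e, map_zero])
  obtain ⟨j, hj⟩ := Function.ne_iff.1 ha0
  -- `A` must avoid `j`, which `t ≤ n - 1` permits. The value `e_j` on `Aᶜ` and the all-zero
  -- observation then exclude each other: together they force `x = e_j`, whose product with `a` is
  -- `a j ≠ 0`, yet `(a | 0)` is in the span of the observed columns.
  obtain ⟨A, hA, hAt⟩ := Finset.exists_subset_card_eq
    (s := Finset.univ.erase j) (n := t) (by simp; omega)
  have hjA : j ∉ A := fun hm => by simpa using hA hm
  refine (condEntropy_lt_entropy (uniformLaw F n η) (fun ω => fun k : ↥(Aᶜ) => ω.1 k)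
    (fun ω => (encode (L.submatrix id (fun w : ↥W => (w : Fin N))) ω.1 ω.2,
        fun k : ↥A => ω.1 k)) (y₀ := fun k => (Pi.single j 1 : Fin n → F) k) (z₀ := (0, 0))
      ?_ ?_ ?_).ne (h A hAt W hW)
  · exact prob_pos _ (fun ω : (Fin n → F) × (Fin η → F) => fun k : ↥(Aᶜ) => ω.1 k)
      (ω := (Pi.single j 1, 0)) (by simp [uniformLaw])
  · have := prob_pos (uniformLaw F n η)
      (fun ω => (encode (L.submatrix id (fun w : ↥W => (w : Fin N))) ω.1 ω.2,
        fun k : ↥A => ω.1 k)) (ω := (0, 0)) (by simp [uniformLaw])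
    simp only [encode_zero] at this
    exact this
  · rw [prob_eq_zero_iff]
    rintro ⟨x, g⟩ - he
    simp only [Prod.mk.injEq] at he
    obtain ⟨hx, hY, hxA⟩ := he
    have hxj : x = Pi.single j 1 := by
      ext k
      by_cases hk : k ∈ A
      · have hkj : k ≠ j := fun e => hjA (e ▸ hk)
        simpa [hkj] using congrFun hxA ⟨k, hk⟩
      · exact congrFun hx ⟨k, by simpa using hk⟩
    have hdot : ∀ w ∈ span F (L.col '' W), Sum.elim x g ⬝ᵥ w = 0 := by
      intro w hw
      induction hw using span_induction with
      | mem w hw =>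
        obtain ⟨c, hc, rfl⟩ := hw
        exact congrFun hY ⟨c, hc⟩
      | zero => simp
      | add v w _ _ hv hw => rw [dotProduct_add, hv, hw, add_zero]
      | smul r w _ hw => rw [dotProduct_smul, hw, smul_zero]
    have := hdot _ ha
    rw [dotProduct_extendZero, hxj] at this
    exact hj (by simpa using this)

end IndexCoding

theorem mainTheorem4 {F : Type*} [Field F] [Fintype F] [DecidableEq F] {m n : ℕ}
    (I : IndexCoding.Instance m n) (hI : Function.Surjective I.demand)
    (μ t δ η N : ℕ) (ht : t < n) (L : Matrix (Fin n ⊕ Fin η) (Fin N) F)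
    (hL : IndexCoding.IsStronglySecure I μ t δ L) :
    IndexCoding.kappa F I + μ + 2 * δ ≤ N := by
  obtain ⟨hE, hS⟩ := hL
  choose u hu hmem using hE.exists_mem_span
  set V₀ := Submodule.span F (Set.range fun i => u i + Pi.single (I.demand i) 1) with hV₀
  set V := V₀.map (IndexCoding.extendZero F n η) with hV
  have hrank : Module.finrank F V = Module.finrank F V₀ :=
    (Submodule.equivMapOfInjective _ IndexCoding.extendZero_injective V₀).finrank_eq.symm
  have hkappa : IndexCoding.kappa F I ≤ Module.finrank F V₀ := Nat.sInf_le ⟨u, hu, rfl⟩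
  have hV₀ne : V₀ ≠ ⊥ := by
    obtain ⟨i, -⟩ := hI ⟨t, ht⟩
    intro hbot
    have h0 := (Submodule.span_eq_bot.1 hbot) _ ⟨i, rfl⟩
    have hui : u i (I.demand i) = 0 := by
      by_contra hne
      exact I.demand_notMem_side i (hu i hne)
    have := congrFun h0 (I.demand i)
    simp [hui] at this
  have hVne : V ≠ ⊥ := by
    intro h
    rw [← Submodule.map_bot (IndexCoding.extendZero F n η)] at h
    exact hV₀ne (Submodule.map_injective_of_injective IndexCoding.extendZero_injective h)
  -- Positivity rules out `N < 2δ`, where the truncated `N - 2 * δ` would be zero.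
  have hpos : 0 < Module.finrank F V := Submodule.one_le_finrank_iff.2 hVne
  have hcard : (Finset.univ.filter fun c : Fin N => 2 * δ ≤ (c : ℕ)).card ≤ N - 2 * δ := by
    calc _ ≤ (Finset.Ico (2 * δ) N).card :=
          Finset.card_le_card_of_injOn (fun c : Fin N => (c : ℕ)) (fun c hc => by simpa using hc)
            Fin.val_injective.injOn
      _ = N - 2 * δ := by simp
  have key := IndexCoding.finrank_add_le_card L.col
    (Finset.univ.filter fun c : Fin N => 2 * δ ≤ (c : ℕ)) μ V hVne
    (by
      rw [hV, Submodule.map_le_iff_le_comap, hV₀, Submodule.span_le]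
      rintro _ ⟨i, rfl⟩
      simpa using hmem i)
    (fun W _ hW => (hS.disjoint ht hW).mono_left (LinearMap.map_le_range))
  omega
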